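/- Let $(M_n,Q_n)$, $n=1,2,\dots$, be independent, identically distributed $\mathbb{R}^2$-valued random vectors with generic copy $(M,Q)$; put $\Pi_0=1$ and $\Pi_n=M_1M_2\cdots M_n$ for $n\ge 1$. Assume that $\mathbb{P}\{M=0\}=0$ and that the series $Z_\infty=\sum_{k\ge 1}\Pi_{k-1}Q_k$ (the perpetuity generated by $(M,Q)$) converges almost surely to a finite limit, i.e. $\lim_{n\to\infty}\sum_{k=1}^{n}\Pi_{k-1}Q_k=Z_\infty\in\mathbb{R}$ a.s. Then the distribution of $Z_\infty$ is of pure type: it is either degenerate (a point mass $\delta_c$ for some $c\in\mathbb{R}$), or absolutely continuous with respect to Lebesgue measure, or singular with respect to Lebesgue measure and continuous (without atoms). In particular, the distribution of $Z_\infty$ is continuous (without atoms) whenever it is nondegenerate. -/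

import Mathlib

open MeasureTheory ProbabilityTheory Filter Topology

/-- The product of the first `n` factors, with the sequence indexed from `0`:
`M 0 * M 1 * ... * M (n - 1)`, and `1` for `n = 0`. -/
def perpetuityProd {Ω : Type*} (M : ℕ → Ω → ℝ) (n : ℕ) (ω : Ω) : ℝ :=
  ∏ i ∈ Finset.range n, M i ω

/-- The partial sum of the first `n` terms of the perpetuity series; the term with index `k`
(counted from `0`) is the product of the first `k` factors times `Q k`. -/
def perpetuitySum {Ω : Type*} (M Q : ℕ → Ω → ℝ) (n : ℕ) (ω : Ω) : ℝ :=
  ∑ k ∈ Finset.range n, perpetuityProd M k ω * Q k ω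

/-- `Z` is (a version of) the almost surely finite perpetuity generated by the sequence
`(M k, Q k)`: almost surely the perpetuity series converges in `ℝ`, possibly only conditionally,
and its sum is `Z`. -/
def IsPerpetuity {Ω : Type*} [MeasurableSpace Ω] (P : Measure Ω) (M Q : ℕ → Ω → ℝ)
    (Z : Ω → ℝ) : Prop :=
  ∀ᵐ ω ∂P, Tendsto (fun n => perpetuitySum M Q n ω) atTop (𝓝 (Z ω))

/-- A law on the real line is degenerate if it is concentrated at a single point. -/
def IsDegenerateLaw (μ : Measure ℝ) : Prop :=
  ∃ c : ℝ, μ = Measure.dirac c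

/-- A law on the real line is continuous if it has no atoms. -/
def IsContinuousLaw (μ : Measure ℝ) : Prop :=
  ∀ x : ℝ, μ {x} = 0

/-! The proof is a zero-one argument. Almost surely `Z = S_n + Π_n Z'`, where `Z'` has the law `ν`
of `Z` and is independent of the first `n` pairs. If `ν` charges `A`, some event `E` depending on
finitely many pairs satisfies `P(Z ∈ A | E) > r`, for any given `r < 1`. Conditioning on the first
`n` pairs makes this probability an average of `ν`-measures of preimages of `A` under maps `z ↦ q +
m * z` with `m ≠ 0`, so one of them exceeds `r` (`exists_affine_preimage_measureReal_gt`).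

Such preimages of a point are points, so one atom forces an atom of mass one. Preimages of a
Lebesgue null set are null, so if `ν` charges a null set, a countable union of them is a null set
carrying `ν`. -/

lemma perpetuityProd_ne_zero {Ω : Type*} {M : ℕ → Ω → ℝ} {ω : Ω} (h : ∀ n, M n ω ≠ 0) (n : ℕ) :
    perpetuityProd M n ω ≠ 0 :=
  Finset.prod_ne_zero_iff.2 fun i _ => h i

lemma perpetuityProd_add {Ω : Type*} (M : ℕ → Ω → ℝ) (n k : ℕ) (ω : Ω) :
    perpetuityProd M (n + k) ω =
      perpetuityProd M n ω * perpetuityProd (fun i => M (n + i)) k ω := by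
  simp [perpetuityProd, Finset.prod_range_add]

lemma perpetuitySum_add {Ω : Type*} (M Q : ℕ → Ω → ℝ) (n k : ℕ) (ω : Ω) :
    perpetuitySum M Q (n + k) ω = perpetuitySum M Q n ω + perpetuityProd M n ω *
      perpetuitySum (fun i => M (n + i)) (fun i => Q (n + i)) k ω := by
  simp [perpetuitySum, Finset.sum_range_add, perpetuityProd_add, Finset.mul_sum, mul_assoc]

lemma measurable_perpetuityProd {Ω : Type*} [MeasurableSpace Ω] {M : ℕ → Ω → ℝ}
    (hM : ∀ n, Measurable (M n)) (n : ℕ) : Measurable (perpetuityProd M n) := by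
  unfold perpetuityProd
  exact Finset.measurable_fun_prod _ fun i _ => hM i

lemma measurable_perpetuitySum {Ω : Type*} [MeasurableSpace Ω] {M Q : ℕ → Ω → ℝ}
    (hM : ∀ n, Measurable (M n)) (hQ : ∀ n, Measurable (Q n)) (n : ℕ) :
    Measurable (perpetuitySum M Q n) := by
  unfold perpetuitySum
  exact Finset.measurable_fun_sum _ fun i _ => (measurable_perpetuityProd hM i).mul (hQ i)

/-- The product of the first coordinates `0, ..., n - 1` of a sequence of pairs. -/
def seqProd (n : ℕ) : (ℕ → ℝ × ℝ) → ℝ := perpetuityProd (fun i x => (x i).1) n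

/-- The partial sum of the perpetuity series, as a function of the sequence of pairs. -/
def seqSum (n : ℕ) : (ℕ → ℝ × ℝ) → ℝ :=
  perpetuitySum (fun i x => (x i).1) (fun i x => (x i).2) n

/-- The sum of the perpetuity series, as a function of the sequence of pairs. -/
noncomputable def seqLim (x : ℕ → ℝ × ℝ) : ℝ := limUnder atTop fun n => seqSum n x

lemma measurable_seqProd (n : ℕ) : Measurable (seqProd n) :=
  measurable_perpetuityProd (fun _ => by fun_prop) n

lemma measurable_seqSum (n : ℕ) : Measurable (seqSum n) :=
  measurable_perpetuitySum (fun _ => by fun_prop) (fun _ => by fun_prop) n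

lemma measurable_seqLim : Measurable seqLim :=
  (StronglyMeasurable.limUnder fun n => (measurable_seqSum n).stronglyMeasurable).measurable

lemma seqProd_congr {n : ℕ} {x y : ℕ → ℝ × ℝ} (h : ∀ i < n, x i = y i) :
    seqProd n x = seqProd n y := by
  unfold seqProd perpetuityProd
  exact Finset.prod_congr rfl fun i hi =>
    congrArg Prod.fst (h i (Finset.mem_range.1 hi))

lemma seqSum_congr {n : ℕ} {x y : ℕ → ℝ × ℝ} (h : ∀ i < n, x i = y i) :
    seqSum n x = seqSum n y := by
  unfold seqSum perpetuitySum
  refine Finset.sum_congr rfl fun i hi => ?_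
  have hi := Finset.mem_range.1 hi
  exact congrArg₂ _ (seqProd_congr fun j hj => h j (hj.trans hi)) (congrArg Prod.snd (h i hi))

/-- Dividing by the nonzero product shows that the shifted series converges too, so its `limUnder`
is a genuine limit. -/
lemma seqLim_eq_add_mul {x : ℕ → ℝ × ℝ} {z : ℝ} (hx : ∀ i, (x i).1 ≠ 0)
    (hz : Tendsto (fun n => seqSum n x) atTop (𝓝 z)) (n : ℕ) :
    seqLim x = seqSum n x + seqProd n x * seqLim (fun k => x (n + k)) := by
  have hp : seqProd n x ≠ 0 :=
    perpetuityProd_ne_zero (M := fun i (x : ℕ → ℝ × ℝ) => (x i).1) hx n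
  have hs : Tendsto (fun k => seqSum k (fun j => x (n + j))) atTop
      (𝓝 ((z - seqSum n x) / seqProd n x)) := by
    have h1 : Tendsto (fun k => seqSum (n + k) x) atTop (𝓝 z) :=
      hz.comp (tendsto_atTop_mono (fun k => Nat.le_add_left k n) tendsto_id)
    refine ((h1.sub_const (seqSum n x)).div_const (seqProd n x)).congr fun k => ?_
    have h2 : seqSum (n + k) x = seqSum n x + seqProd n x * seqSum k (fun j => x (n + j)) :=
      perpetuitySum_add _ _ n k x
    rw [h2, add_sub_cancel_left, mul_div_cancel_left₀ _ hp]
  rw [show seqLim x = z from hz.limUnder_eq, show seqLim (fun k => x (n + k)) = _ from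
    hs.limUnder_eq, mul_div_cancel₀ _ hp]
  ring

/-- The sequence `x` with all terms from index `n` on replaced by `0`. -/
def seqTrunc (n : ℕ) (x : ℕ → ℝ × ℝ) (i : ℕ) : ℝ × ℝ := if i < n then x i else 0

lemma ProbabilityTheory.iIndepFun.indepFun_seqTrunc_shift {Ω : Type*} [MeasurableSpace Ω]
    {P : Measure Ω} {X : ℕ → Ω → ℝ × ℝ} (hX : ∀ n, Measurable (X n)) (hind : iIndepFun X P)
    (n : ℕ) :
    IndepFun (fun ω => seqTrunc n fun i => X i ω) (fun ω k => X (n + k) ω) P := by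
  have hdisj : Disjoint (Set.Iio n) (Set.Ici n) :=
    Set.disjoint_left.2 fun i h1 h2 => absurd (Set.mem_Iio.1 h1) (not_lt.2 h2)
  have h := indep_iSup_of_disjoint (fun i => (hX i).comap_le) hind hdisj
  refine (IndepFun_iff_Indep _ _ _).2 (indep_of_indep_of_le_right
    (indep_of_indep_of_le_left h ?_) ?_)
  · refine Measurable.comap_le ?_
    refine @measurable_pi_lambda _ _ _ (_) _ _ fun i => ?_
    by_cases hi : i < n
    · simp only [seqTrunc, hi, if_true]
      exact Measurable.mono (comap_measurable (X i))
        (le_iSup₂_of_le i (Set.mem_Iio.2 hi) le_rfl) le_rfl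
    · simp only [seqTrunc, hi, if_false]
      exact measurable_const
  · refine Measurable.comap_le ?_
    refine @measurable_pi_lambda _ _ _ (_) _ _ fun k => ?_
    exact Measurable.mono (comap_measurable (X (n + k)))
      (le_iSup₂_of_le (n + k) (Set.mem_Ici.2 (Nat.le_add_right n k)) le_rfl) le_rfl

/-- A measurable set of positive measure fills, up to a small proportion, some set from any
generating algebra. -/
lemma exists_mem_isSetAlgebra_mul_lt_measureReal_inter {α : Type*} {mα : MeasurableSpace α}
    {μ : Measure α} [IsFiniteMeasure μ] {C : Set (Set α)} (hC : IsSetAlgebra C)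
    (hgen : mα = MeasurableSpace.generateFrom C) {B : Set α} (hB : MeasurableSet B)
    (hpos : 0 < μ.real B) {r : ℝ} (hr : 0 ≤ r) (hr1 : r < 1) :
    ∃ E ∈ C, r * μ.real E < μ.real (E ∩ B) := by
  -- If `μ (E ∆ B) < δ`, then `μ (E ∩ B) - r * μ E` exceeds `(1 - r) * μ B - 2 * δ`, which is
  -- positive for this `δ`.
  have hδ : 0 < (1 - r) * μ.real B / 3 := by
    have := mul_pos (sub_pos.2 hr1) hpos
    linarith
  obtain ⟨E, hE, hlt⟩ := exists_measure_symmDiff_lt_of_generateFrom_isSetRing (μ := μ)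
    hC.isSetRing ⟨{Set.univ}, Set.countable_singleton _, by simpa using hC.univ_mem, by simp⟩
    hgen hB (ENNReal.ofReal_pos.2 hδ)
  refine ⟨E, hE, ?_⟩
  have hd : μ.real (symmDiff E B) < (1 - r) * μ.real B / 3 :=
    (ENNReal.lt_ofReal_iff_toReal_lt (measure_ne_top _ _)).1 hlt
  have h1 : μ.real B ≤ μ.real (E ∩ B) + μ.real (symmDiff E B) := by
    refine (measureReal_mono ?_).trans (measureReal_union_le _ _)
    intro x hx
    by_cases hxE : x ∈ E
    · exact Or.inl ⟨hxE, hx⟩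
    · exact Or.inr (Or.inr ⟨hx, hxE⟩)
  have h2 : μ.real E ≤ μ.real B + μ.real (symmDiff E B) := by
    refine (measureReal_mono ?_).trans (measureReal_union_le _ _)
    intro x hx
    by_cases hxB : x ∈ B
    · exact Or.inl hxB
    · exact Or.inr (Or.inl ⟨hx, hxB⟩)
  have h3 := mul_le_mul_of_nonneg_left h2 hr
  have h4 : r * μ.real (symmDiff E B) ≤ μ.real (symmDiff E B) :=
    mul_le_of_le_one_left measureReal_nonneg hr1.le
  nlinarith

/-- If a sequence of random pairs is i.i.d. with nonzero first coordinates and its perpetuity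
series converges, then every set charged by the law of the sum has affine preimages of
probability arbitrarily close to one. -/
lemma exists_affine_preimage_measureReal_gt {Ω : Type*} [MeasurableSpace Ω] {P : Measure Ω}
    [IsProbabilityMeasure P] {X : ℕ → Ω → ℝ × ℝ} (hX : ∀ n, Measurable (X n))
    (hind : iIndepFun X P) (hident : ∀ n, IdentDistrib (X n) (X 0) P P)
    (hne : ∀ n, ∀ᵐ ω ∂P, (X n ω).1 ≠ 0)
    (hconv : ∀ᵐ ω ∂P, ∃ z, Tendsto (fun n => seqSum n fun i => X i ω) atTop (𝓝 z))
    {A : Set ℝ} (hA : MeasurableSet A)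
    (hpos : P.map (fun ω => seqLim fun i => X i ω) A ≠ 0) {r : ℝ} (hr : 0 ≤ r) (hr1 : r < 1) :
    ∃ m q : ℝ, m ≠ 0 ∧
      r < (P.map (fun ω => seqLim fun i => X i ω)).real ((fun z => q + m * z) ⁻¹' A) := by
  by_contra! hcon
  set ν := P.map (fun ω => seqLim fun i => X i ω) with hν
  have hXm : Measurable fun ω i => X i ω := measurable_pi_lambda _ hX
  set μ := P.map (fun ω i => X i ω) with hμ
  have : IsProbabilityMeasure μ := Measure.isProbabilityMeasure_map hXm.aemeasurable
  have hνμ : ν = μ.map seqLim := by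
    rw [hμ, Measure.map_map measurable_seqLim hXm]; rfl
  have : IsProbabilityMeasure ν := by
    rw [hνμ]; exact Measure.isProbabilityMeasure_map measurable_seqLim.aemeasurable
  have hB : MeasurableSet (seqLim ⁻¹' A) := measurable_seqLim hA
  have hBpos : 0 < μ.real (seqLim ⁻¹' A) := by
    rw [hνμ, Measure.map_apply measurable_seqLim hA] at hpos
    exact ENNReal.toReal_pos hpos (measure_ne_top _ _)
  obtain ⟨E, hE, hlt⟩ := exists_mem_isSetAlgebra_mul_lt_measureReal_inter (μ := μ)
    (isSetAlgebra_measurableCylinders (α := fun _ : ℕ => ℝ × ℝ))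
    generateFrom_measurableCylinders.symm hB hBpos hr hr1
  have hEm : MeasurableSet E := .of_mem_measurableCylinders hE
  obtain ⟨s, S, hS, rfl⟩ := (mem_measurableCylinders _).1 hE
  obtain ⟨n, hn⟩ : ∃ n, ∀ i ∈ s, i < n :=
    ⟨s.sup id + 1, fun i hi => Nat.lt_succ_of_le (Finset.le_sup (f := id) hi)⟩
  refine hlt.not_ge ?_
  -- Padding with zeros keeps the past in the full sequence space; the cylinder, `seqSum n` and
  -- `seqProd n` never read the padding.
  set V : Ω → ℕ → ℝ × ℝ := fun ω => seqTrunc n fun i => X i ω with hV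
  set W : Ω → ℕ → ℝ × ℝ := fun ω k => X (n + k) ω with hW
  have htr : ∀ ω, ∀ i < n, V ω i = X i ω := fun ω i hi => by simp [hV, seqTrunc, hi]
  have hVm : Measurable V := by
    refine measurable_pi_lambda _ fun i => ?_
    by_cases hi : i < n
    · simpa [hV, seqTrunc, hi] using hX i
    · simp [hV, seqTrunc, hi]
  have hWm : Measurable W := measurable_pi_lambda _ fun k => hX (n + k)
  have hWlaw : P.map W = μ := by
    refine (IdentDistrib.pi (X := fun k => X (n + k)) (Y := X)
      (fun k => (hident (n + k)).trans (hident k).symm) ?_ hind).map_eq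
    exact hind.precomp (add_right_injective n)
  have hjoint : P.map (fun ω => (V ω, W ω)) = (P.map V).prod μ := by
    rw [← hWlaw]
    exact (hind.indepFun_seqTrunc_shift hX n).map_prod_eq_prod_map_map hVm.aemeasurable
      hWm.aemeasurable
  have hcyl : ∀ ω, V ω ∈ cylinder s S ↔ (fun i => X i ω) ∈ cylinder s S := fun ω => by
    rw [mem_cylinder, mem_cylinder]
    have : s.restrict (V ω) = s.restrict fun i => X i ω := by
      ext1 i
      exact htr ω i (hn i i.2)
    rw [this]
  -- Requiring a nonzero product costs only a null event and lets `hcon` bound every section of `D`,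
  -- not just almost every one.
  set D : Set ((ℕ → ℝ × ℝ) × (ℕ → ℝ × ℝ)) :=
    {p | p.1 ∈ cylinder s S ∧ seqProd n p.1 ≠ 0 ∧
      seqSum n p.1 + seqProd n p.1 * seqLim p.2 ∈ A} with hD
  have hDm : MeasurableSet D := by
    refine (measurable_fst hEm).inter (MeasurableSet.inter ?_ ?_)
    · exact ((measurable_seqProd n).comp measurable_fst) (measurableSet_singleton 0).compl
    · exact (((measurable_seqSum n).comp measurable_fst).add
        (((measurable_seqProd n).comp measurable_fst).mul
          (measurable_seqLim.comp measurable_snd))) hA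
  have hμE : (P.map V) (cylinder s S) = μ (cylinder s S) := by
    rw [Measure.map_apply hVm hEm, hμ, Measure.map_apply hXm hEm]
    exact congrArg P (Set.ext hcyl)
  have hle : μ (cylinder s S ∩ seqLim ⁻¹' A) ≤ P.map (fun ω => (V ω, W ω)) D := by
    rw [hμ, Measure.map_apply hXm (hEm.inter hB), Measure.map_apply (hVm.prodMk hWm) hDm]
    refine measure_mono_ae ?_
    filter_upwards [ae_all_iff.2 hne, hconv] with ω h1 ⟨z, hz⟩ ⟨h2, h3⟩
    refine ⟨(hcyl ω).2 h2, ?_, ?_⟩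
    · rw [seqProd_congr (htr ω)]
      exact perpetuityProd_ne_zero (M := fun i (x : ℕ → ℝ × ℝ) => (x i).1) h1 n
    · change seqSum n (V ω) + seqProd n (V ω) * seqLim (W ω) ∈ A
      rw [seqProd_congr (htr ω), seqSum_congr (htr ω), ← seqLim_eq_add_mul h1 hz n]
      exact h3
  have hsec : ∀ v, μ (Prod.mk v ⁻¹' D) ≤
      (cylinder s S).indicator (fun _ => ENNReal.ofReal r) v := by
    intro v
    by_cases hv : v ∈ cylinder s S ∧ seqProd n v ≠ 0
    · rw [Set.indicator_of_mem hv.1]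
      have h1 : Prod.mk v ⁻¹' D ⊆
          seqLim ⁻¹' ((fun z => seqSum n v + seqProd n v * z) ⁻¹' A) := fun w hw => hw.2.2
      refine (measure_mono h1).trans ?_
      rw [← Measure.map_apply measurable_seqLim ((by fun_prop : Measurable fun z =>
        seqSum n v + seqProd n v * z) hA), ← hνμ]
      exact (ENNReal.le_ofReal_iff_toReal_le (measure_ne_top _ _) hr).2 (hcon _ _ hv.2)
    · have h1 : Prod.mk v ⁻¹' D = ∅ :=
        Set.eq_empty_of_forall_notMem fun w hw => hv ⟨hw.1, hw.2.1⟩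
      rw [h1, measure_empty]
      exact zero_le
  have hfin : μ (cylinder s S ∩ seqLim ⁻¹' A) ≤ ENNReal.ofReal r * μ (cylinder s S) := by
    refine hle.trans ?_
    rw [hjoint, Measure.prod_apply hDm, ← hμE]
    exact (lintegral_mono hsec).trans_eq (lintegral_indicator_const hEm _)
  have := ENNReal.toReal_mono (ENNReal.mul_ne_top ENNReal.ofReal_ne_top (measure_ne_top _ _)) hfin
  rwa [ENNReal.toReal_mul, ENNReal.toReal_ofReal hr] at this

/-- A law all of whose charged sets have affine preimages of probability close to one is
degenerate as soon as it has an atom. -/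
lemma isDegenerateLaw_of_atom {ν : Measure ℝ} [IsProbabilityMeasure ν]
    (h : ∀ A : Set ℝ, MeasurableSet A → ν A ≠ 0 → ∀ r : ℝ, 0 ≤ r → r < 1 →
      ∃ m q : ℝ, m ≠ 0 ∧ r < ν.real ((fun z => q + m * z) ⁻¹' A))
    {x : ℝ} (hx : ν {x} ≠ 0) : IsDegenerateLaw ν := by
  have hs : ∀ r : ℝ, 0 ≤ r → r < 1 → ∃ y, r < ν.real {y} := fun r hr hr1 => by
    obtain ⟨m, q, hm, hlt⟩ := h {x} (measurableSet_singleton x) hx r hr hr1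
    refine ⟨(x - q) / m, hlt.trans_eq (congrArg _ ?_)⟩
    ext z
    simp only [Set.mem_preimage, Set.mem_singleton_iff, eq_div_iff hm]
    constructor <;> intro hz <;> linarith
  -- Two distinct atoms cannot both exceed 1/2, so the atoms found for larger `r` all sit at this
  -- `c`.
  obtain ⟨c, hc⟩ := hs (1 / 2) (by norm_num) (by norm_num)
  have hc1 : 1 ≤ ν.real {c} := by
    refine le_of_forall_lt fun r hr => ?_
    obtain ⟨y, hy⟩ := hs (max r (1 / 2)) (by positivity) (max_lt hr (by norm_num))
    have hyc : y = c := by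
      by_contra hne
      have h2 := measureReal_union (μ := ν) (Set.disjoint_singleton.2 hne)
        (measurableSet_singleton c)
      have h3 := measureReal_le_one (μ := ν) (s := {y} ∪ {c})
      have := le_max_right r (1 / 2)
      linarith
    exact (le_max_left _ _).trans_lt (hyc ▸ hy)
  have hc2 : ν {c} = 1 := by
    refine le_antisymm prob_le_one ?_
    have := ENNReal.ofReal_le_ofReal hc1
    rwa [ENNReal.ofReal_one, ofReal_measureReal] at this
  refine ⟨c, ?_⟩
  have hae : ∀ᵐ z ∂ν, z = c := by
    rw [← prob_compl_eq_zero_iff (measurableSet_singleton c)] at hc2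
    exact hc2
  have : ν.map id = ν.map fun _ => c := Measure.map_congr hae
  simpa using this

/-- A law all of whose charged sets have affine preimages of probability close to one is either
absolutely continuous or singular. -/
lemma absolutelyContinuous_or_mutuallySingular_volume {ν : Measure ℝ} [IsProbabilityMeasure ν]
    (h : ∀ A : Set ℝ, MeasurableSet A → ν A ≠ 0 → ∀ r : ℝ, 0 ≤ r → r < 1 →
      ∃ m q : ℝ, m ≠ 0 ∧ r < ν.real ((fun z => q + m * z) ⁻¹' A)) :
    ν ≪ (volume : Measure ℝ) ∨ ν ⟂ₘ (volume : Measure ℝ) := by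
  refine or_iff_not_imp_left.2 fun hac => ?_
  obtain ⟨A, hA, hA0, hνA⟩ : ∃ A : Set ℝ, MeasurableSet A ∧ volume A = 0 ∧ ν A ≠ 0 := by
    by_contra! hcon
    exact hac (Measure.AbsolutelyContinuous.mk hcon)
  have hr : ∀ n : ℕ, (0 : ℝ) ≤ 1 - 1 / ((n : ℝ) + 1) ∧ 1 - 1 / ((n : ℝ) + 1) < 1 := fun n => by
    have h1 : (0 : ℝ) < 1 / ((n : ℝ) + 1) := by positivity
    have h2 : 1 / ((n : ℝ) + 1) ≤ 1 := by
      rw [div_le_one (by positivity)]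
      linarith [n.cast_nonneg (α := ℝ)]
    exact ⟨by linarith, by linarith⟩
  choose m q hm hlt using fun n : ℕ => h A hA hνA _ (hr n).1 (hr n).2
  set N : Set ℝ := ⋃ n, (fun z => q n + m n * z) ⁻¹' A with hN
  have hNm : MeasurableSet N :=
    MeasurableSet.iUnion fun n => (by fun_prop : Measurable fun z => q n + m n * z) hA
  have hN0 : volume N = 0 := by
    refine measure_iUnion_null fun n => ?_
    have : (fun z => q n + m n * z) ⁻¹' A = (fun z => m n * z) ⁻¹' ((fun z => q n + z) ⁻¹' A) :=
      rfl
    rw [this, Real.volume_preimage_mul_left (hm n), measure_preimage_add, hA0, mul_zero]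
  have hN1 : 1 ≤ ν.real N := by
    have hlim : Tendsto (fun n : ℕ => 1 - 1 / ((n : ℝ) + 1)) atTop (𝓝 1) := by
      simpa using tendsto_one_div_add_atTop_nhds_zero_nat.const_sub (1 : ℝ)
    exact le_of_tendsto' hlim fun n =>
      (hlt n).le.trans (measureReal_mono
        (Set.subset_iUnion (fun n => (fun z => q n + m n * z) ⁻¹' A) n))
  have hνN : ν N = 1 := by
    refine le_antisymm prob_le_one ?_
    have := ENNReal.ofReal_le_ofReal hN1
    rwa [ENNReal.ofReal_one, ofReal_measureReal] at this
  exact ⟨Nᶜ, hNm.compl, (prob_compl_eq_zero_iff hNm).2 hνN, by rwa [compl_compl]⟩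

theorem theorem1
    {Ω : Type*} [MeasurableSpace Ω] (P : Measure Ω) [IsProbabilityMeasure P]
    {Ω₀ : Type*} [MeasurableSpace Ω₀] (P₀ : Measure Ω₀) [IsProbabilityMeasure P₀]
    (Ms Qs : ℕ → Ω → ℝ) (M Q : Ω₀ → ℝ)
    (hMs : ∀ n, Measurable (Ms n)) (hQs : ∀ n, Measurable (Qs n))
    (hindep : iIndepFun (fun (n : ℕ) (ω : Ω) => ((Ms n ω, Qs n ω) : ℝ × ℝ)) P)
    (hident : ∀ n, IdentDistrib (fun ω => ((Ms n ω, Qs n ω) : ℝ × ℝ))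
      (fun ω => ((M ω, Q ω) : ℝ × ℝ)) P P₀)
    (hM : P₀ {ω | M ω = 0} = 0)
    (Z : Ω → ℝ) (hZ : IsPerpetuity P Ms Qs Z) :
    AEMeasurable Z P ∧
    (IsDegenerateLaw (P.map Z) ∨
      P.map Z ≪ (volume : Measure ℝ) ∨
      (P.map Z ⟂ₘ (volume : Measure ℝ) ∧ IsContinuousLaw (P.map Z))) ∧
    (¬ IsDegenerateLaw (P.map Z) → IsContinuousLaw (P.map Z)) := by
  set X : ℕ → Ω → ℝ × ℝ := fun n ω => (Ms n ω, Qs n ω) with hXdef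
  have hX : ∀ n, Measurable (X n) := fun n => (hMs n).prodMk (hQs n)
  have hXident : ∀ n, IdentDistrib (X n) (X 0) P P := fun n => (hident n).trans (hident 0).symm
  have hne : ∀ n, ∀ᵐ ω ∂P, (X n ω).1 ≠ 0 := fun n => by
    refine (hident n).symm.ae_snd (p := fun p : ℝ × ℝ => p.1 ≠ 0) ?_ ?_
    · exact measurable_fst (measurableSet_singleton (0 : ℝ)).compl
    · simpa [ae_iff] using hM
  have hZX : ∀ᵐ ω ∂P, Tendsto (fun n => seqSum n fun i => X i ω) atTop (𝓝 (Z ω)) := hZ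
  have hZeq : Z =ᵐ[P] fun ω => seqLim fun i => X i ω := by
    filter_upwards [hZX] with ω h using h.limUnder_eq.symm
  have hZm : AEMeasurable Z P :=
    ⟨_, measurable_seqLim.comp (measurable_pi_lambda _ hX), hZeq⟩
  have : IsProbabilityMeasure (P.map Z) := Measure.isProbabilityMeasure_map hZm
  have key : ∀ A : Set ℝ, MeasurableSet A → P.map Z A ≠ 0 → ∀ r : ℝ, 0 ≤ r → r < 1 →
      ∃ m q : ℝ, m ≠ 0 ∧ r < (P.map Z).real ((fun z => q + m * z) ⁻¹' A) := by
    rw [Measure.map_congr hZeq]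
    intro A hA hpos r hr hr1
    exact exists_affine_preimage_measureReal_gt hX hindep hXident hne
      (hZX.mono fun ω h => ⟨_, h⟩) hA hpos hr hr1
  have hcont : ¬ IsDegenerateLaw (P.map Z) → IsContinuousLaw (P.map Z) := fun hnd x => by
    by_contra hx
    exact hnd (isDegenerateLaw_of_atom key hx)
  refine ⟨hZm, ?_, hcont⟩
  by_cases hd : IsDegenerateLaw (P.map Z)
  · exact Or.inl hd
  · exact Or.inr ((absolutelyContinuous_or_mutuallySingular_volume key).imp_right
      fun hs => ⟨hs, hcont hd⟩)
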